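/- **Proposition 1 (Approximation with the PIRPNN).** Let $0\le a<b$ and $t_0\in\mathbb R$. Consider either of the following initial-value problems. (A) *ODE in canonical form:* $\frac{du}{dt}=f(t,u)$, $u(t_0)=z\in\mathbb R^m$, where $f$ is continuous on a set $D\subset\mathbb R\times\mathbb R^m$ and Lipschitz continuous in $u$ there, uniformly in $t$. (B) *Index-1 DAE in semiexplicit form:* $\frac{du}{dt}=f(t,u,v)$, $0=g(t,u,v)$, $u(t_0)=z\in\mathbb R^{p}$, $v(t_0)=y\in\mathbb R^{q}$, where $f$ is continuous on a set $D\subset\mathbb R\times\mathbb R^p\times\mathbb R^q$ and Lipschitz continuous in $(u,v)$ there, uniformly in $t$, $g$ takes values in $\mathbb R^q$ and is continuously differentiable near every point of $D$, and the Jacobian $\nabla_v g$ is nonsingular at every point of $D$ where $g=0$. A solution on $[t_0,t_{end}]$ is a differentiable $u$ (in case (B) a differentiable $u$ together with a continuous $v$) that satisfies the equations and initial conditions on $[t_0,t_{end}]$ and whose graph lies in $D$. 1. *Existence.* If $D$ contains all points with $t\ge t_0$ of some neighbourhood of $(t_0,z)$ (in case (B): of $(t_0,z,y)$, and $g(t_0,z,y)=0$),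 then there is a solution on $[t_0,t_{end}]$ for some $t_{end}>t_0$. 2. *Uniqueness and regularity.* For every $t_{end}>t_0$, a solution on $[t_0,t_{end}]$ is unique if it exists, and its component $u$ is continuously differentiable. 3. *Approximation.* Suppose that $t_{end}>t_0$ and that a solution exists on $[t_0,t_{end}]$. Write $x_i$ for its components (those of $u$, in case (B) those of $u$ and $v$) and $x_i^0$ for their initial values. For each $N$ let the shape parameters $\alpha_{ji}=\alpha^{(N)}_{ji}$, $j=1,\dots,N$, be drawn i.i.d. (over all $j$ and $i$) from the uniform distribution on $(a,b)$, let $t_j=t_0+(j-1)\frac{t_{end}-t_0}{N-1}$, and consider the networks $$\Psi_{Ni}(t)=x_i^0+(t-t_0)\sum_{j=1}^N w_{ji}\,e^{-\alpha_{ji}(t-t_j)^2}.$$ Then the output weights $w_{ji}$ can be chosen, for every $N$, as functions of the sampled shape parameters such that $\Psi_{Ni}$ converges to $x_i$ uniformly on $[t_0,t_{end}]$ as $N\to\infty$, for all $i$, with high probability: for all $\varepsilon,\delta>0$ there is $N_0$ such that for every $N\ge N_0$, with probability at least $1-\delta$, $|\Psi_{Ni}(t)-x_i(t)|<\varepsilon$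 for all $i$ and all $t\in[t_0,t_{end}]$; moreover, with probability one, $\Psi_{Ni}\to x_i$ uniformly on $[t_0,t_{end}]$ for all $i$. -/

import Mathlib

open MeasureTheory ProbabilityTheory Set Filter Topology

/-- The Gaussian radial basis function with input weight `w`, bias `b`, shape parameter `α`
and center `c`. -/
noncomputable def gaussianRBF (w b α c t : ℝ) : ℝ :=
  Real.exp (-α * (w * t + b - c) ^ 2)

/-- The `N` equispaced centers of `[t₀, T]`; the index `j` runs through `0, …, N - 1`. -/
noncomputable def rbfCenter (t₀ T : ℝ) (N : ℕ) (j : Fin N) : ℝ :=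
  t₀ + (j : ℝ) * ((T - t₀) / ((N : ℝ) - 1))

/-- One network with initial value `z`, shape parameters `α` and output weights `w`; the input
weights are one and the biases are zero. -/
noncomputable def pirpnn (t₀ T z : ℝ) {N : ℕ} (α w : Fin N → ℝ) (t : ℝ) : ℝ :=
  z + (t - t₀) * ∑ j, w j * gaussianRBF 1 0 (α j) (rbfCenter t₀ T N j) t

/-- The random variables `X k` are independent, each uniformly distributed on `(a, b)`. -/
def IsIIDUniform {Ω κ : Type*} [MeasurableSpace Ω] (P : Measure Ω) (a b : ℝ)
    (X : κ → Ω → ℝ) : Prop :=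
  (∀ k, Measurable (X k)) ∧ iIndepFun X P ∧ ∀ k, pdf.IsUniform (X k) (Ioo a b) P volume

/-- The networks (one for each component `i`) with the random shape parameters
`α N i j`, `j < N`, converge uniformly on `[t₀, T]` to `u`: the output weights `W N` can be chosen
as functions of the sampled shape parameters such that all uniform errors are below `ε`, except
on an event of probability at most `δ`, for all large `N`; and such that the networks converge
uniformly with probability one. -/
def PIRPNNConverges {Ω ι : Type*} [MeasurableSpace Ω] (P : Measure Ω)
    (α : (N : ℕ) → ι → Fin N → Ω → ℝ) (t₀ T : ℝ) (z : ι → ℝ) (u : ℝ → ι → ℝ) : Prop :=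
  ∃ W : (N : ℕ) → (ι → Fin N → ℝ) → ι → Fin N → ℝ,
    (∀ ε > (0 : ℝ), ∀ δ > (0 : ℝ), ∃ N₀ : ℕ, ∀ N ≥ N₀,
      P {ω | ∃ i, ∃ t ∈ Icc t₀ T,
        ε ≤ |pirpnn t₀ T (z i) (fun j => α N i j ω) (W N (fun i j => α N i j ω) i) t - u t i|}
        ≤ ENNReal.ofReal δ) ∧
    (∀ᵐ ω ∂P, ∀ i, TendstoUniformlyOn
      (fun N t => pirpnn t₀ T (z i) (fun j => α N i j ω) (W N (fun i j => α N i j ω) i) t)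
      (fun t => u t i) atTop (Icc t₀ T))

/-- `u` solves `u' = f(t, u)`, `u(t₀) = z` on `[t₀, T]`, with its graph in `D`. -/
def IsODESolution {m : ℕ} (f : ℝ → (Fin m → ℝ) → (Fin m → ℝ)) (D : Set (ℝ × (Fin m → ℝ)))
    (t₀ T : ℝ) (z : Fin m → ℝ) (u : ℝ → Fin m → ℝ) : Prop :=
  u t₀ = z ∧ ∀ t ∈ Icc t₀ T,
    (t, u t) ∈ D ∧ HasDerivWithinAt u (f t (u t)) (Icc t₀ T) t

/-- `(u, v)` solves the semiexplicit system `u' = f(t, u, v)`, `0 = g(t, u, v)` on `[t₀, T]`,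
with `u(t₀) = z`, `v(t₀) = y`, with `v` continuous and with the graph of `(u, v)` in `D`. -/
def IsDAESolution {p q : ℕ} (f : ℝ → (Fin p → ℝ) → (Fin q → ℝ) → (Fin p → ℝ))
    (g : ℝ → (Fin p → ℝ) → (Fin q → ℝ) → (Fin q → ℝ))
    (D : Set (ℝ × (Fin p → ℝ) × (Fin q → ℝ))) (t₀ T : ℝ) (z : Fin p → ℝ) (y : Fin q → ℝ)
    (u : ℝ → Fin p → ℝ) (v : ℝ → Fin q → ℝ) : Prop :=
  u t₀ = z ∧ v t₀ = y ∧ ContinuousOn v (Icc t₀ T) ∧ ∀ t ∈ Icc t₀ T,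
    (t, u t, v t) ∈ D ∧ HasDerivWithinAt u (f t (u t) (v t)) (Icc t₀ T) t ∧
      g t (u t) (v t) = 0

/-! Existence for the ODE is Picard–Lindelöf and uniqueness is Gronwall. Near a consistent point of
the DAE the implicit function theorem gives `v = φ(t, u)` with `φ` Lipschitz, which reduces it to an
ODE; local uniqueness then spreads over the interval by continuous induction.

The approximation uses only that the solution is continuous. Up to a small error, `x_i(t) - x_i^0`
equals `(t - t₀) φ(t)` with `φ` continuous, and `φ` is approximated by finitely many Gaussians with
one fixed shape parameter (`topologicalClosure_span_gaussianMap`). Such a combination tolerates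
small changes of shapes and centres (`exists_finset_forall_exists_mem_span`). A number of centres
proportional to `N` lies near any prescribed one, and each has an independent shape parameter that
hits the prescribed neighbourhood with fixed positive probability. The failure probability therefore
decays geometrically: it tends to zero, and it is summable, so Borel–Cantelli gives almost sure
convergence. -/

/-! ### Local existence and regularity for an abstract ODE. -/

section InitialValueProblem

variable {E : Type*} [NormedAddCommGroup E] [NormedSpace ℝ E]

/-- **Picard–Lindelöf** on a one-sided neighbourhood of the initial point. -/
theorem exists_forall_mem_hasDerivWithinAt_of_lipschitzOnWith [CompleteSpace E]
    {f : ℝ → E → E} {D : Set (ℝ × E)} {K : NNReal} {t₀ : ℝ} {z : E}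
    (hc : ContinuousOn (fun x : ℝ × E => f x.1 x.2) D)
    (hl : ∀ t, LipschitzOnWith K (f t) {x | (t, x) ∈ D})
    (hD : D ∈ 𝓝[Ici t₀ ×ˢ univ] (t₀, z)) :
    ∃ T > t₀, ∃ u : ℝ → E, u t₀ = z ∧ ∀ t ∈ Icc t₀ T,
      (t, u t) ∈ D ∧ HasDerivWithinAt u (f t (u t)) (Icc t₀ T) t := by
  have hmem : (t₀, z) ∈ D := mem_of_mem_nhdsWithin (by simp) hD
  set L : NNReal := ‖f t₀ z‖₊ + 1 with hL
  have hbd : ∀ᶠ x in 𝓝[Ici t₀ ×ˢ univ] (t₀, z), ‖f x.1 x.2‖ ≤ L := by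
    have h1 : Tendsto (fun x : ℝ × E => ‖f x.1 x.2‖) (𝓝[Ici t₀ ×ˢ univ] (t₀, z))
        (𝓝 ‖f t₀ z‖) := ((hc _ hmem).norm.tendsto).mono_left (nhdsWithin_le_of_mem hD)
    filter_upwards [h1.eventually_lt_const (show ‖f t₀ z‖ < L by simp [hL])] with x hx using hx.le
  obtain ⟨ε, hε, hball⟩ := Metric.mem_nhdsWithin_iff.1 (inter_mem hD hbd)
  have hL0 : (0 : ℝ) < L := by simp only [hL]; push_cast; positivity
  set a : NNReal := ⟨ε / 2, by positivity⟩ with ha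
  -- The first bound keeps `t` in the ball; the second gives `L * τ ≤ a`, so the solution cannot
  -- leave the closed ball.
  set τ : ℝ := min (ε / 2) (ε / 2 / L) with hτ
  have hτ0 : 0 < τ := by positivity
  have hS : ∀ t ∈ Icc t₀ (t₀ + τ), ∀ x ∈ Metric.closedBall z a,
      (t, x) ∈ D ∧ ‖f t x‖ ≤ L := by
    intro t ht x hx
    have h1 : (a : ℝ) = ε / 2 := rfl
    have h2 : τ ≤ ε / 2 := min_le_left _ _
    refine hball ⟨?_, ⟨ht.1, mem_univ _⟩⟩
    rw [Metric.mem_closedBall] at hx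
    rw [Metric.mem_ball, Prod.dist_eq, max_lt_iff, Real.dist_eq]
    exact ⟨by rw [abs_of_nonneg] <;> linarith [ht.1, ht.2], by linarith⟩
  have hPL : IsPicardLindelof f (tmin := t₀) (tmax := t₀ + τ) ⟨t₀, by simp [hτ0.le]⟩ z a 0 L K := by
    refine ⟨fun t ht => (hl t).mono fun x hx => (hS t ht x hx).1, fun x hx => ?_,
      fun t ht x hx => (hS t ht x hx).2, ?_⟩
    · exact hc.comp (f := fun t => (t, x)) (by fun_prop) fun t ht => (hS t ht x hx).1
    · simp only [add_sub_cancel_left, sub_self, NNReal.coe_zero, sub_zero]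
      rw [max_eq_left hτ0.le]
      calc (L : ℝ) * τ ≤ L * (ε / 2 / L) := by gcongr; exact min_le_right _ _
        _ = a := by rw [mul_div_cancel₀ _ hL0.ne']; rfl
  obtain ⟨u, hu0, hu⟩ := hPL.exists_eq_forall_mem_Icc_hasDerivWithinAt₀
  simp only at hu0
  have hlt : t₀ < t₀ + τ := by linarith
  -- The existence theorem used here returns no information on the graph; continuity of `u` places
  -- it in `D` after shortening the interval.
  have hev : ∀ᶠ t in 𝓝[≥] t₀, (t, u t) ∈ D := by
    have h1 : Tendsto u (𝓝[≥] t₀) (𝓝 z) := by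
      have := (hu t₀ ⟨le_rfl, hlt.le⟩).continuousWithinAt
      rw [ContinuousWithinAt, hu0] at this
      exact this.mono_left (nhdsWithin_le_of_mem (Icc_mem_nhdsGE hlt))
    have h2 : Tendsto (fun t => (t, u t)) (𝓝[≥] t₀) (𝓝[Ici t₀ ×ˢ univ] (t₀, z)) := by
      refine tendsto_nhdsWithin_iff.2
        ⟨(tendsto_id.mono_left nhdsWithin_le_nhds).prodMk_nhds h1, ?_⟩
      filter_upwards [self_mem_nhdsWithin] with t ht using ⟨ht, mem_univ _⟩
    exact h2.eventually hD
  obtain ⟨T, hT, hsub⟩ := mem_nhdsGE_iff_exists_Icc_subset.1 (inter_mem hev (Icc_mem_nhdsGE hlt))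
  refine ⟨T, hT, u, hu0, fun t ht => ⟨(hsub ht).1, ?_⟩⟩
  exact (hu t (hsub ht).2).mono fun s hs => (hsub hs).2

theorem HasDerivWithinAt.Ici_of_Icc {u : ℝ → E} {u' : E} {t₀ T t : ℝ}
    (h : HasDerivWithinAt u u' (Icc t₀ T) t) (ht : t ∈ Ico t₀ T) :
    HasDerivWithinAt u u' (Ici t) t :=
  h.mono_of_mem_nhdsWithin (Icc_mem_nhdsGE_of_mem ht)

theorem contDiffOn_one_Icc_of_hasDerivWithinAt {u u' : ℝ → E} {t₀ T : ℝ} (hT : t₀ < T)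
    (hu : ∀ t ∈ Icc t₀ T, HasDerivWithinAt u (u' t) (Icc t₀ T) t)
    (hu' : ContinuousOn u' (Icc t₀ T)) : ContDiffOn ℝ 1 u (Icc t₀ T) := by
  have hud := uniqueDiffOn_Icc hT
  refine (contDiffOn_one_iff_derivWithin hud).2
    ⟨fun t ht => (hu t ht).differentiableWithinAt, hu'.congr fun t ht => ?_⟩
  exact (hu t ht).derivWithin (hud t ht)

end InitialValueProblem

/-! ### The ODE in canonical form. -/

section ODE

variable {m : ℕ} {f : ℝ → (Fin m → ℝ) → (Fin m → ℝ)} {D : Set (ℝ × (Fin m → ℝ))} {t₀ T : ℝ}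
  {z : Fin m → ℝ} {u u' : ℝ → Fin m → ℝ}

theorem IsODESolution.continuousOn (h : IsODESolution f D t₀ T z u) :
    ContinuousOn u (Icc t₀ T) := fun t ht => (h.2 t ht).2.continuousWithinAt

theorem IsODESolution.eqOn {K : NNReal} (hl : ∀ t, LipschitzOnWith K (f t) {x | (t, x) ∈ D})
    (h : IsODESolution f D t₀ T z u) (h' : IsODESolution f D t₀ T z u') :
    EqOn u' u (Icc t₀ T) :=
  ODE_solution_unique_of_mem_Icc_right (v := f) (s := fun t => {x | (t, x) ∈ D})
    (fun t _ => hl t) h'.continuousOn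
    (fun t ht => (h'.2 t (Ico_subset_Icc_self ht)).2.Ici_of_Icc ht)
    (fun t ht => (h'.2 t (Ico_subset_Icc_self ht)).1) h.continuousOn
    (fun t ht => (h.2 t (Ico_subset_Icc_self ht)).2.Ici_of_Icc ht)
    (fun t ht => (h.2 t (Ico_subset_Icc_self ht)).1) (h'.1.trans h.1.symm)

theorem IsODESolution.contDiffOn (hT : t₀ < T)
    (hc : ContinuousOn (fun x : ℝ × (Fin m → ℝ) => f x.1 x.2) D)
    (h : IsODESolution f D t₀ T z u) : ContDiffOn ℝ 1 u (Icc t₀ T) :=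
  contDiffOn_one_Icc_of_hasDerivWithinAt hT (fun t ht => (h.2 t ht).2)
    (hc.comp (f := fun t => (t, u t)) (continuousOn_id.prodMk h.continuousOn)
      fun t ht => (h.2 t ht).1)

end ODE

/-! ### The index-1 DAE, reduced locally to an ODE. -/

section DAE

variable {p q : ℕ} {f : ℝ → (Fin p → ℝ) → (Fin q → ℝ) → (Fin p → ℝ)}
  {g : ℝ → (Fin p → ℝ) → (Fin q → ℝ) → (Fin q → ℝ)}
  {D : Set (ℝ × (Fin p → ℝ) × (Fin q → ℝ))} {t₀ T : ℝ} {z : Fin p → ℝ} {y : Fin q → ℝ}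
  {u u' : ℝ → Fin p → ℝ} {v v' : ℝ → Fin q → ℝ}

/-- Near a point where `∇_v g` is nonsingular, the constraint `g = 0` defines `v` as a Lipschitz
function `φ` of `(t, u)`. -/
theorem exists_lipschitzOnWith_implicit {t : ℝ} {x : Fin p → ℝ} {w : Fin q → ℝ}
    (hg : ContDiffAt ℝ 1 (fun x : ℝ × (Fin p → ℝ) × (Fin q → ℝ) => g x.1 x.2.1 x.2.2) (t, x, w))
    (hg0 : g t x w = 0) (hdet : (fderiv ℝ (g t x) w).det ≠ 0) :
    ∃ φ : ℝ × (Fin p → ℝ) → (Fin q → ℝ), ∃ L : NNReal, ∃ U ∈ 𝓝 (t, x),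
      LipschitzOnWith L φ U ∧ φ (t, x) = w ∧ (∀ s ∈ U, g s.1 s.2 (φ s) = 0) ∧
      ∀ᶠ s : ℝ × (Fin p → ℝ) × (Fin q → ℝ) in 𝓝 (t, x, w),
        g s.1 s.2.1 s.2.2 = 0 → φ (s.1, s.2.1) = s.2.2 := by
  let G : (ℝ × (Fin p → ℝ)) × (Fin q → ℝ) → (Fin q → ℝ) := fun s => g s.1.1 s.1.2 s.2
  have hG : ContDiffAt ℝ 1 G ((t, x), w) :=
    ContDiffAt.comp (g := fun x : ℝ × (Fin p → ℝ) × (Fin q → ℝ) => g x.1 x.2.1 x.2.2)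
      (f := fun s : (ℝ × (Fin p → ℝ)) × (Fin q → ℝ) => (s.1.1, s.1.2, s.2)) ((t, x), w) hg
      (by fun_prop)
  -- By the chain rule this restriction of the full derivative is `∇_v g`, so the determinant
  -- condition applies.
  have hinv : (fderiv ℝ G ((t, x), w) ∘L .inr ℝ (ℝ × (Fin p → ℝ)) (Fin q → ℝ)).IsInvertible := by
    have h1 : HasFDerivAt (g t x)
        (fderiv ℝ G ((t, x), w) ∘L .inr ℝ (ℝ × (Fin p → ℝ)) (Fin q → ℝ)) w :=
      HasFDerivAt.comp (g := G) (f := fun w => ((t, x), w)) w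
        (hG.differentiableAt one_ne_zero).hasFDerivAt (hasFDerivAt_prodMk_right _ _)
    rw [← h1.fderiv]
    exact ⟨(fderiv ℝ (g t x) w).toContinuousLinearEquivOfDetNeZero hdet, by ext; simp⟩
  set φ := hG.implicitFunction one_ne_zero hinv with hφ
  have hφ0 : φ (t, x) = w := hG.implicitFunction_apply_self one_ne_zero hinv
  obtain ⟨L, U, hU, hLU⟩ :=
    (hG.contDiffAt_implicitFunction one_ne_zero hinv).exists_lipschitzOnWith
  have h1 := hG.eventually_apply_implicitFunction one_ne_zero hinv
  have h2 := hG.eventually_apply_eq_iff_implicitFunction one_ne_zero hinv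
  have hG0 : G ((t, x), w) = 0 := hg0
  refine ⟨φ, L, U ∩ {s | G (s, φ s) = G ((t, x), w)}, inter_mem hU h1,
    hLU.mono inter_subset_left, hφ0, fun s hs => hs.2.trans hG0, ?_⟩
  have h3 : Tendsto (fun s : ℝ × (Fin p → ℝ) × (Fin q → ℝ) => ((s.1, s.2.1), s.2.2))
      (𝓝 (t, x, w)) (𝓝 ((t, x), w)) := Continuous.tendsto (by fun_prop) _
  filter_upwards [h3.eventually h2] with s hs h using hs.1 (h.trans hG0.symm)

/-- Provides the Lipschitz hypothesis for the reduced ODE, both for existence and for uniqueness;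
`max 1 L` is the constant of `x ↦ (x, φ (t, x))` in the sup norm. -/
theorem lipschitzOnWith_comp_implicit {K L : NNReal} {φ : ℝ × (Fin p → ℝ) → (Fin q → ℝ)}
    {U : Set (ℝ × (Fin p → ℝ))}
    (hl : ∀ t, LipschitzOnWith K (fun x : (Fin p → ℝ) × (Fin q → ℝ) => f t x.1 x.2)
      {x | (t, x) ∈ D}) (hφ : LipschitzOnWith L φ U) (t : ℝ) :
    LipschitzOnWith (K * max 1 L) (fun x => f t x (φ (t, x)))
      {x | (t, x) ∈ U ∧ (t, x, φ (t, x)) ∈ D} := by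
  have h1 : LipschitzOnWith L (fun x => φ (t, x)) {x | (t, x) ∈ U ∧ (t, x, φ (t, x)) ∈ D} := by
    have h := hφ.comp (g := φ) (f := fun x => (t, x))
      (s := {x | (t, x) ∈ U ∧ (t, x, φ (t, x)) ∈ D})
      ((LipschitzWith.prodMk_left t).lipschitzOnWith) fun x hx => hx.1
    rwa [mul_one] at h
  exact (hl t).comp (f := fun x => (x, φ (t, x)))
    (LipschitzWith.id.lipschitzOnWith.prodMk h1) fun x hx => hx.2

theorem exists_isDAESolution {K : NNReal}
    (hc : ContinuousOn (fun x : ℝ × (Fin p → ℝ) × (Fin q → ℝ) => f x.1 x.2.1 x.2.2) D)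
    (hl : ∀ t, LipschitzOnWith K (fun x : (Fin p → ℝ) × (Fin q → ℝ) => f t x.1 x.2)
      {x | (t, x) ∈ D})
    (hg : ∀ x ∈ D, ContDiffAt ℝ 1
      (fun x : ℝ × (Fin p → ℝ) × (Fin q → ℝ) => g x.1 x.2.1 x.2.2) x)
    (hdet : ∀ x ∈ D, g x.1 x.2.1 x.2.2 = 0 → (fderiv ℝ (g x.1 x.2.1) x.2.2).det ≠ 0)
    (hD : D ∈ 𝓝[Ici t₀ ×ˢ univ] (t₀, z, y)) (hg0 : g t₀ z y = 0) :
    ∃ T > t₀, ∃ u v, IsDAESolution f g D t₀ T z y u v := by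
  have hmem : (t₀, z, y) ∈ D := mem_of_mem_nhdsWithin (by simp) hD
  obtain ⟨φ, L, U, hU, hLU, hφ0, hφg, -⟩ :=
    exists_lipschitzOnWith_implicit (hg _ hmem) hg0 (hdet _ hmem hg0)
  have hφc : Tendsto φ (𝓝 (t₀, z)) (𝓝 y) := by
    have := hLU.continuousOn.continuousAt hU
    rwa [ContinuousAt, hφ0] at this
  let D' : Set (ℝ × (Fin p → ℝ)) := {s | s ∈ U ∧ (s.1, s.2, φ s) ∈ D}
  have hgraph : ContinuousOn (fun s : ℝ × (Fin p → ℝ) => (s.1, s.2, φ s)) D' :=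
    continuousOn_fst.prodMk (continuousOn_snd.prodMk (hLU.continuousOn.mono fun s hs => hs.1))
  have hD' : D' ∈ 𝓝[Ici t₀ ×ˢ univ] (t₀, z) := by
    refine inter_mem (mem_nhdsWithin_of_mem_nhds hU) ?_
    have h1 : Tendsto (fun s : ℝ × (Fin p → ℝ) => (s.1, s.2, φ s)) (𝓝[Ici t₀ ×ˢ univ] (t₀, z))
        (𝓝[Ici t₀ ×ˢ univ] (t₀, z, y)) := by
      refine tendsto_nhdsWithin_iff.2 ⟨Tendsto.mono_left ?_ nhdsWithin_le_nhds, ?_⟩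
      · exact (continuous_fst.tendsto (t₀, z)).prodMk_nhds
          ((continuous_snd.tendsto (t₀, z)).prodMk_nhds hφc)
      · filter_upwards [self_mem_nhdsWithin] with s hs using ⟨hs.1, mem_univ _⟩
    exact h1.eventually hD
  obtain ⟨T, hT, u, hu0, hu⟩ := exists_forall_mem_hasDerivWithinAt_of_lipschitzOnWith
    (f := fun t x => f t x (φ (t, x))) (D := D') (hc.comp hgraph fun s hs => hs.2)
    (lipschitzOnWith_comp_implicit hl hLU) hD'
  have huc : ContinuousOn u (Icc t₀ T) := fun t ht => (hu t ht).2.continuousWithinAt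
  refine ⟨T, hT, u, fun t => φ (t, u t), hu0, by simp only [hu0, hφ0], ?_,
    fun t ht => ⟨(hu t ht).1.2, (hu t ht).2, hφg _ (hu t ht).1.1⟩⟩
  exact hLU.continuousOn.comp (f := fun t => (t, u t)) (continuousOn_id.prodMk huc)
    fun t ht => (hu t ht).1.1

theorem IsDAESolution.continuousOn (h : IsDAESolution f g D t₀ T z y u v) :
    ContinuousOn (fun t => (t, u t, v t)) (Icc t₀ T) :=
  continuousOn_id.prodMk (ContinuousOn.prodMk
    (fun t ht => (h.2.2.2 t ht).2.1.continuousWithinAt) h.2.2.1)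

theorem IsDAESolution.contDiffOn (hT : t₀ < T)
    (hc : ContinuousOn (fun x : ℝ × (Fin p → ℝ) × (Fin q → ℝ) => f x.1 x.2.1 x.2.2) D)
    (h : IsDAESolution f g D t₀ T z y u v) : ContDiffOn ℝ 1 u (Icc t₀ T) :=
  contDiffOn_one_Icc_of_hasDerivWithinAt hT (fun t ht => (h.2.2.2 t ht).2.1)
    (hc.comp h.continuousOn fun t ht => (h.2.2.2 t ht).1)

/-- Two solutions which agree at a time `s` agree shortly after `s`. -/
theorem IsDAESolution.eventuallyEq_nhdsGT {K : NNReal}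
    (hl : ∀ t, LipschitzOnWith K (fun x : (Fin p → ℝ) × (Fin q → ℝ) => f t x.1 x.2)
      {x | (t, x) ∈ D})
    (hg : ∀ x ∈ D, ContDiffAt ℝ 1
      (fun x : ℝ × (Fin p → ℝ) × (Fin q → ℝ) => g x.1 x.2.1 x.2.2) x)
    (hdet : ∀ x ∈ D, g x.1 x.2.1 x.2.2 = 0 → (fderiv ℝ (g x.1 x.2.1) x.2.2).det ≠ 0)
    (h : IsDAESolution f g D t₀ T z y u v) (h' : IsDAESolution f g D t₀ T z y u' v')
    {s : ℝ} (hs : s ∈ Ico t₀ T) (hsu : u' s = u s) (hsv : v' s = v s) :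
    ∀ᶠ t in 𝓝[>] s, u' t = u t ∧ v' t = v t := by
  have hsI := Ico_subset_Icc_self hs
  have hmem := (h.2.2.2 s hsI).1
  have hg0 := (h.2.2.2 s hsI).2.2
  obtain ⟨φ, L, U, hU, hLU, -, -, hφ⟩ :=
    exists_lipschitzOnWith_implicit (hg _ hmem) hg0 (hdet _ hmem hg0)
  -- By continuity any such solution stays near `(s, u s, v s)` for a while, where every zero of `g`
  -- lies on the graph of `φ`. Continuity of `v` is essential here: it excludes jumps to another
  -- branch.
  have key : ∀ {u₁ : ℝ → Fin p → ℝ} {v₁ : ℝ → Fin q → ℝ}, IsDAESolution f g D t₀ T z y u₁ v₁ →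
      u₁ s = u s → v₁ s = v s →
      ∀ᶠ t in 𝓝[≥] s, t ∈ Icc t₀ T ∧ (t, u₁ t) ∈ U ∧ v₁ t = φ (t, u₁ t) := by
    intro u₁ v₁ h₁ hsu₁ hsv₁
    have h2 : Tendsto (fun t => (t, u₁ t, v₁ t)) (𝓝[≥] s) (𝓝 (s, u s, v s)) := by
      have := (h₁.continuousOn s hsI).mono_of_mem_nhdsWithin (Icc_mem_nhdsGE_of_mem hs)
      rwa [ContinuousWithinAt, hsu₁, hsv₁] at this
    have h3 : Tendsto (fun t => (t, u₁ t)) (𝓝[≥] s) (𝓝 (s, u s)) :=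
      (Continuous.tendsto (f := fun x : ℝ × (Fin p → ℝ) × (Fin q → ℝ) => (x.1, x.2.1))
        (by fun_prop) (s, u s, v s)).comp h2
    have h4 : ∀ᶠ t in 𝓝[≥] s, t ∈ Icc t₀ T := Icc_mem_nhdsGE_of_mem hs
    filter_upwards [h4, h3.eventually hU, h2.eventually hφ] with t ht htU htφ
    exact ⟨ht, htU, (htφ (h₁.2.2.2 t ht).2.2).symm⟩
  obtain ⟨r, hr, hsub⟩ := mem_nhdsGE_iff_exists_Icc_subset.1
    ((key h rfl rfl).and (key h' hsu hsv))
  have hIcc : Icc s r ⊆ Icc t₀ T := fun t ht => (hsub ht).1.1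
  have hrT : r ≤ T := (hIcc ⟨le_of_lt hr, le_rfl⟩).2
  have hIco : Ico s r ⊆ Ico t₀ T := fun t ht => ⟨hs.1.trans ht.1, ht.2.trans_le hrT⟩
  have side : ∀ {u₁ : ℝ → Fin p → ℝ} {v₁ : ℝ → Fin q → ℝ}, IsDAESolution f g D t₀ T z y u₁ v₁ →
      (∀ t ∈ Icc s r, (t, u₁ t) ∈ U ∧ v₁ t = φ (t, u₁ t)) →
      ContinuousOn u₁ (Icc s r) ∧
      (∀ t ∈ Ico s r, HasDerivWithinAt u₁ (f t (u₁ t) (φ (t, u₁ t))) (Ici t) t) ∧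
      ∀ t ∈ Ico s r, (t, u₁ t) ∈ U ∧ (t, u₁ t, φ (t, u₁ t)) ∈ D := by
    intro u₁ v₁ h₁ hφ₁
    refine ⟨fun t ht => (h₁.2.2.2 t (hIcc ht)).2.1.continuousWithinAt.mono hIcc,
      fun t ht => ?_, fun t ht => ?_⟩
    · have := (h₁.2.2.2 t (hIcc (Ico_subset_Icc_self ht))).2.1.Ici_of_Icc (hIco ht)
      rwa [(hφ₁ t (Ico_subset_Icc_self ht)).2] at this
    · have := (h₁.2.2.2 t (hIcc (Ico_subset_Icc_self ht))).1
      rw [(hφ₁ t (Ico_subset_Icc_self ht)).2] at this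
      exact ⟨(hφ₁ t (Ico_subset_Icc_self ht)).1, this⟩
  obtain ⟨c1, d1, m1⟩ := side h fun t ht => (hsub ht).1.2
  obtain ⟨c2, d2, m2⟩ := side h' fun t ht => (hsub ht).2.2
  have huniq : EqOn u' u (Icc s r) :=
    ODE_solution_unique_of_mem_Icc_right (v := fun t x => f t x (φ (t, x)))
      (s := fun t => {x | (t, x) ∈ U ∧ (t, x, φ (t, x)) ∈ D})
      (fun t _ => lipschitzOnWith_comp_implicit hl hLU t) c2 d2 m2 c1 d1 m1 hsu
  filter_upwards [nhdsWithin_mono s Ioi_subset_Ici_self (Icc_mem_nhdsGE hr)] with t ht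
  refine ⟨huniq ht, ?_⟩
  rw [(hsub ht).1.2.2, (hsub ht).2.2.2, huniq ht]

/-- `φ` exists only locally, so uniqueness is continued: the set of agreement is closed and extends
to the right of each of its points before `T`. -/
theorem IsDAESolution.eqOn {K : NNReal}
    (hl : ∀ t, LipschitzOnWith K (fun x : (Fin p → ℝ) × (Fin q → ℝ) => f t x.1 x.2)
      {x | (t, x) ∈ D})
    (hg : ∀ x ∈ D, ContDiffAt ℝ 1
      (fun x : ℝ × (Fin p → ℝ) × (Fin q → ℝ) => g x.1 x.2.1 x.2.2) x)
    (hdet : ∀ x ∈ D, g x.1 x.2.1 x.2.2 = 0 → (fderiv ℝ (g x.1 x.2.1) x.2.2).det ≠ 0)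
    (h : IsDAESolution f g D t₀ T z y u v) (h' : IsDAESolution f g D t₀ T z y u' v') :
    EqOn u' u (Icc t₀ T) ∧ EqOn v' v (Icc t₀ T) := by
  let A : Set ℝ := {t | (t, u' t, v' t) = (t, u t, v t)}
  have hA : IsClosed (A ∩ Icc t₀ T) := by
    rw [inter_comm]
    exact (h'.continuousOn.prodMk h.continuousOn).preimage_isClosed_of_isClosed isClosed_Icc
      isClosed_diagonal
  have hsub : Icc t₀ T ⊆ A := by
    refine hA.Icc_subset_of_forall_mem_nhdsWithin ?_ fun s hs => ?_
    · simp only [A, mem_ofPred_eq, h.1, h'.1, h.2.1, h'.2.1]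
    · have h1 : u' s = u s ∧ v' s = v s := by simpa [A] using hs.1
      filter_upwards [h.eventuallyEq_nhdsGT hl hg hdet h' hs.2 h1.1 h1.2] with t ht
      simp [A, ht.1, ht.2]
  have hsub' : ∀ t ∈ Icc t₀ T, u' t = u t ∧ v' t = v t := fun t ht => by simpa [A] using hsub ht
  exact ⟨fun t ht => (hsub' t ht).1, fun t ht => (hsub' t ht).2⟩

end DAE

/-! ### Totality of Gaussians in `C([t₀, T])`. -/

section Density

/-- The difference quotients lie in `V`, which is closed. This allows differentiation of Gaussians
with respect to the centre. -/
theorem HasDerivAt.mem_of_eventually_mem {E : Type*} [NormedAddCommGroup E] [NormedSpace ℝ E]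
    {V : Submodule ℝ E} (hV : IsClosed (V : Set E)) {h : ℝ → E} {h' : E} {c : ℝ}
    (hd : HasDerivAt h h' c) (hmem : ∀ᶠ s in 𝓝 c, h s ∈ V) : h' ∈ V := by
  refine hV.mem_of_tendsto hd.tendsto_slope ?_
  filter_upwards [nhdsWithin_le_nhds hmem] with s hs
  exact V.smul_mem _ (V.sub_mem hs hmem.self_of_nhds)

theorem ContinuousMap.exp_apply {X : Type*} [TopologicalSpace X] [CompactSpace X] (f : C(X, ℝ))
    (x : X) : NormedSpace.exp f x = Real.exp (f x) := by
  let _ : NormedAlgebra ℚ C(X, ℝ) := NormedAlgebra.restrictScalars ℚ ℝ C(X, ℝ)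
  rw [Real.exp_eq_exp_ℝ]
  exact NormedSpace.map_exp (ContinuousMap.evalAlgHom ℝ ℝ x) (continuous_eval_const x) f

/-- The Gaussian with shape parameter `p.1` and centre `p.2` as a continuous function on
`[t₀, T]`. -/
noncomputable def gaussianMap (t₀ T : ℝ) (p : ℝ × ℝ) : C(Icc t₀ T, ℝ) :=
  ⟨fun t => gaussianRBF 1 0 p.1 p.2 t, by unfold gaussianRBF; fun_prop⟩

theorem gaussianMap_apply (t₀ T : ℝ) (p : ℝ × ℝ) (t : Icc t₀ T) :
    gaussianMap t₀ T p t = gaussianRBF 1 0 p.1 p.2 t := rfl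

theorem continuous_gaussianMap (t₀ T : ℝ) : Continuous (gaussianMap t₀ T) := by
  refine ContinuousMap.continuous_of_continuous_uncurry _ ?_
  simp only [Function.uncurry_def, gaussianMap_apply, gaussianRBF]
  fun_prop

/-- Gaussians with a fixed shape parameter and centres in an interval are total in
`C([t₀, T])`. -/
theorem topologicalClosure_span_gaussianMap {t₀ T α c₁ c₂ : ℝ} (hα : 0 < α) (hc : c₁ < c₂) :
    (Submodule.span ℝ (gaussianMap t₀ T '' ({α} ×ˢ Ioo c₁ c₂))).topologicalClosure = ⊤ := by
  set V := (Submodule.span ℝ (gaussianMap t₀ T '' ({α} ×ˢ Ioo c₁ c₂))).topologicalClosure with hV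
  have hVc : IsClosed (V : Set C(Icc t₀ T, ℝ)) := Submodule.isClosed_topologicalClosure _
  let X : C(Icc t₀ T, ℝ) := ⟨fun t => t, continuous_subtype_val⟩
  let Y : C(Icc t₀ T, ℝ) := (2 * α) • X
  -- Expanding the square, the Gaussian with centre `c` is `exp (-α c²)` times `B * exp (c • Y)`;
  -- each derivative in `c` brings down a factor `Y`.
  let B : C(Icc t₀ T, ℝ) := NormedSpace.exp ((-α) • X ^ 2)
  have hmem : ∀ n : ℕ, ∀ c ∈ Ioo c₁ c₂, B * (NormedSpace.exp (c • Y) * Y ^ n) ∈ V := by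
    intro n
    induction n with
    | zero =>
      intro c hc
      have h1 : B * (NormedSpace.exp (c • Y) * Y ^ 0) =
          Real.exp (α * c ^ 2) • gaussianMap t₀ T (α, c) := by
        ext t
        simp only [pow_zero, mul_one, ContinuousMap.mul_apply, ContinuousMap.smul_apply, B, Y, X,
          ContinuousMap.exp_apply, ContinuousMap.pow_apply, gaussianMap_apply, gaussianRBF,
          smul_eq_mul, ContinuousMap.coe_mk, ← Real.exp_add]
        congr 1
        ring
      rw [h1]
      exact V.smul_mem _ (Submodule.le_topologicalClosure _ (Submodule.subset_span
        (mem_image_of_mem _ ⟨rfl, hc⟩)))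
    | succ n ih =>
      intro c hc
      have hd : HasDerivAt (fun s : ℝ => B * (NormedSpace.exp (s • Y) * Y ^ n))
          (B * (NormedSpace.exp (c • Y) * Y * Y ^ n)) c :=
        ((hasDerivAt_exp_smul_const Y c).mul_const _).const_mul _
      rw [pow_succ', ← mul_assoc (NormedSpace.exp (c • Y))]
      exact hd.mem_of_eventually_mem hVc (eventually_of_mem (isOpen_Ioo.mem_nhds hc) ih)
  obtain ⟨c, hc⟩ := exists_between hc
  set M : C(Icc t₀ T, ℝ) := B * NormedSpace.exp (c • Y) with hM
  -- `V'` is closed and contains all polynomials, hence is everything by Weierstrass. As `M` has no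
  -- zeros, every function is a multiple of `M`, so `V` is everything too.
  let V' : Submodule ℝ C(Icc t₀ T, ℝ) := V.comap (LinearMap.mulLeft ℝ M)
  have hV'c : IsClosed (V' : Set C(Icc t₀ T, ℝ)) :=
    hVc.preimage (f := fun φ => M * φ) (by fun_prop)
  have hX : ∀ n : ℕ, X ^ n ∈ V' := by
    intro n
    have h1 : X ^ n = (2 * α)⁻¹ ^ n • Y ^ n := by
      rw [smul_pow, smul_smul, ← mul_pow, inv_mul_cancel₀ (by positivity), one_pow, one_smul]
    rw [h1]
    refine V'.smul_mem _ ?_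
    change M * Y ^ n ∈ V
    rw [hM, mul_assoc]
    exact hmem n c hc
  have hpoly : (polynomialFunctions (Icc t₀ T) : Set C(Icc t₀ T, ℝ)) ⊆ V' := by
    rw [polynomialFunctions_coe]
    rintro _ ⟨P, rfl⟩
    have h1 : Polynomial.toContinuousMapOnAlgHom (Icc t₀ T) P =
        ∑ i ∈ Finset.range (P.natDegree + 1), P.coeff i • X ^ i := by
      ext t
      simp [Polynomial.eval_eq_sum_range, X, ContinuousMap.sum_apply]
    rw [h1]
    exact V'.sum_mem fun i _ => V'.smul_mem _ (hX i)
  have hV' : ∀ φ : C(Icc t₀ T, ℝ), M * φ ∈ V := fun φ =>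
    closure_minimal hpoly hV'c (continuousMap_mem_polynomialFunctions_closure t₀ T φ)
  refine (Submodule.eq_top_iff').2 fun φ => ?_
  have hMpos : ∀ t, M t ≠ 0 := fun t => by
    simp only [hM, B, ContinuousMap.mul_apply, ContinuousMap.exp_apply]
    positivity
  have h2 : φ = M * ⟨fun t => (M t)⁻¹ * φ t, (M.continuous.inv₀ hMpos).mul φ.continuous⟩ := by
    ext t
    simp [mul_inv_cancel_left₀ (hMpos t)]
  rw [h2]
  exact hV' _

/-- An element of the closed span of `G '' S` can be approximated from the span of any family
of values of `G` taken at points that come close enough to suitable finitely many points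
of `S`. -/
theorem exists_finset_forall_exists_mem_span {X E : Type*} [PseudoMetricSpace X]
    [NormedAddCommGroup E] [NormedSpace ℝ E] {G : X → E} (hG : Continuous G) {S : Set X} {ψ : E}
    (hψ : ψ ∈ (Submodule.span ℝ (G '' S)).topologicalClosure) {ε : ℝ} (hε : 0 < ε) :
    ∃ s : Finset X, ↑s ⊆ S ∧ ∃ η > 0, ∀ {κ : Type} (p : κ → X),
      (∀ x ∈ s, ∃ j, dist (p j) x < η) →
      ∃ χ ∈ Submodule.span ℝ (range fun j => G (p j)), dist ψ χ < ε := by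
  classical
  have key : ∀ ψ ∈ Submodule.span ℝ (G '' S), ∀ ε > 0,
      ∃ s : Finset X, ↑s ⊆ S ∧ ∃ η > 0, ∀ {κ : Type} (p : κ → X),
      (∀ x ∈ s, ∃ j, dist (p j) x < η) →
      ∃ χ ∈ Submodule.span ℝ (range fun j => G (p j)), dist ψ χ < ε := by
    intro ψ hψ
    induction hψ using Submodule.span_induction with
    | mem ψ h =>
      obtain ⟨x, hx, rfl⟩ := h
      intro ε hε
      obtain ⟨η, hη, h⟩ := Metric.continuous_iff.1 hG x ε hε
      refine ⟨{x}, by simpa using hx, η, hη, fun p hp => ?_⟩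
      obtain ⟨j, hj⟩ := hp x (by simp)
      exact ⟨G (p j), Submodule.subset_span ⟨j, rfl⟩, by rw [dist_comm]; exact h _ hj⟩
    | zero =>
      intro ε hε
      exact ⟨∅, by simp, 1, one_pos, fun p _ => ⟨0, Submodule.zero_mem _, by simpa using hε⟩⟩
    | add x y _ _ hx hy =>
      intro ε hε
      obtain ⟨s₁, hs₁, η₁, hη₁, h₁⟩ := hx (ε / 2) (half_pos hε)
      obtain ⟨s₂, hs₂, η₂, hη₂, h₂⟩ := hy (ε / 2) (half_pos hε)
      refine ⟨s₁ ∪ s₂, by simp [hs₁, hs₂], min η₁ η₂, lt_min hη₁ hη₂, fun p hp => ?_⟩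
      obtain ⟨χ₁, hχ₁, hd₁⟩ := h₁ p fun x hx =>
        (hp x (Finset.mem_union_left _ hx)).imp fun _ h => h.trans_le (min_le_left _ _)
      obtain ⟨χ₂, hχ₂, hd₂⟩ := h₂ p fun x hx =>
        (hp x (Finset.mem_union_right _ hx)).imp fun _ h => h.trans_le (min_le_right _ _)
      refine ⟨χ₁ + χ₂, Submodule.add_mem _ hχ₁ hχ₂, ?_⟩
      linarith [dist_add_add_le x y χ₁ χ₂]
    | smul r x _ hx =>
      intro ε hε
      have hr : 0 < ‖r‖ + 1 := by positivity
      obtain ⟨s, hs, η, hη, h⟩ := hx (ε / (‖r‖ + 1)) (div_pos hε hr)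
      refine ⟨s, hs, η, hη, fun p hp => ?_⟩
      obtain ⟨χ, hχ, hd⟩ := h p hp
      refine ⟨r • χ, Submodule.smul_mem _ _ hχ, ?_⟩
      rw [dist_smul₀]
      rw [lt_div_iff₀ hr] at hd
      nlinarith [norm_nonneg r, dist_nonneg (x := x) (y := χ)]
  obtain ⟨ψ', hψ', hd⟩ := Metric.mem_closure_iff.1 hψ (ε / 2) (half_pos hε)
  obtain ⟨s, hs, η, hη, h⟩ := key ψ' hψ' (ε / 2) (half_pos hε)
  refine ⟨s, hs, η, hη, fun p hp => ?_⟩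
  obtain ⟨χ, hχ, hd'⟩ := h p hp
  exact ⟨χ, hχ, by linarith [dist_triangle ψ ψ' χ]⟩

/-- A continuous function that vanishes at `t₀` is uniformly close to `(t - t₀) * φ t` with
`φ` continuous. -/
theorem exists_continuousMap_sub_mul_lt {t₀ T : ℝ} {h : ℝ → ℝ} (hT : t₀ < T)
    (hc : ContinuousOn h (Icc t₀ T)) (h0 : h t₀ = 0) {ε : ℝ} (hε : 0 < ε) :
    ∃ φ : C(Icc t₀ T, ℝ), ∀ t : Icc t₀ T, |((t : ℝ) - t₀) * φ t - h t| < ε := by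
  have hcw := hc t₀ ⟨le_rfl, hT.le⟩
  obtain ⟨d, hd, hball⟩ := Metric.continuousWithinAt_iff.1 hcw ε hε
  have hpos : ∀ t : Icc t₀ T, max ((t : ℝ) - t₀) (d / 2) ≠ 0 := fun t =>
    (lt_max_of_lt_right (half_pos hd)).ne'
  -- Truncating the denominator avoids any differentiability of `h` at `t₀`. Where the truncation
  -- acts, `|h| < ε` and the product is `s * h` with `0 ≤ s ≤ 1`.
  have hcφ : Continuous fun t : Icc t₀ T => h t / max ((t : ℝ) - t₀) (d / 2) :=
    (continuousOn_iff_continuous_domRestrict.1 hc).div (by fun_prop) hpos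
  refine ⟨⟨_, hcφ⟩, fun t => ?_⟩
  have ht := t.2
  rw [ContinuousMap.coe_mk]
  rcases le_or_gt (d / 2) ((t : ℝ) - t₀) with h1 | h1
  · rw [max_eq_left h1, mul_div_cancel₀ _ (by linarith : (0 : ℝ) < (t : ℝ) - t₀).ne', sub_self,
      abs_zero]
    exact hε
  · have h2 : |h t| < ε := by
      have := hball ht (by rw [Real.dist_eq, abs_of_nonneg] <;> linarith [ht.1])
      rwa [h0, dist_zero_right, Real.norm_eq_abs] at this
    rw [max_eq_right h1.le]
    set s := ((t : ℝ) - t₀) / (d / 2) with hs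
    have hs0 : 0 ≤ s := div_nonneg (by linarith [ht.1]) (by linarith)
    have hs1 : s ≤ 1 := (div_le_one (by linarith)).2 h1.le
    have h3 : ((t : ℝ) - t₀) * (h t / (d / 2)) - h t = -((1 - s) * h t) := by rw [hs]; ring
    rw [h3, abs_neg, abs_mul, abs_of_nonneg (by linarith)]
    nlinarith [abs_nonneg (h t)]

end Density

/-! ### Probability that samples come near prescribed pairs. -/

section Sampling

variable {Ω : Type*} [MeasurableSpace Ω] {P : Measure Ω}

/-- Near an interior point `c` there are at least `(N - 1) / d` of the `N` equispaced centres. -/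
theorem exists_injective_rbfCenter_sub_lt {t₀ T c η : ℝ} (hc : c ∈ Ioo t₀ T) (hη : 0 < η) :
    ∃ d > 0, ∀ N : ℕ, ∃ e : Fin ((N - 1) / d) → Fin N, Function.Injective e ∧
      ∀ i, |rbfCenter t₀ T N (e i) - c| < η := by
  have hT : t₀ < T := hc.1.trans hc.2
  -- The centres used lie to the right of `c`; the bound `T - c` keeps their indices below `N`. With
  -- `d > (T - t₀) / η'`, a run of `(N - 1) / d` steps is shorter than `η'`.
  set η' := min η (T - c) with hη'
  have hη'0 : 0 < η' := lt_min hη (by linarith [hc.2])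
  obtain ⟨d, hd⟩ := exists_nat_gt ((T - t₀) / η')
  have hd0 : (0 : ℝ) < d := (div_pos (by linarith) hη'0).trans hd
  refine ⟨d, by exact_mod_cast hd0, fun N => ?_⟩
  rcases Nat.lt_or_ge N 2 with hN | hN
  · have : (N - 1) / d = 0 := by rw [show N - 1 = 0 by omega, Nat.zero_div]
    rw [this]
    exact ⟨Fin.elim0, fun i => i.elim0, fun i => i.elim0⟩
  have hN1 : (0 : ℝ) < (N : ℝ) - 1 := by
    have : (2 : ℝ) ≤ N := by exact_mod_cast hN
    linarith
  set h := (T - t₀) / ((N : ℝ) - 1) with hh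
  have hh0 : 0 < h := div_pos (by linarith) hN1
  have hmh : (((N - 1) / d : ℕ) : ℝ) * h < η' := by
    have h1 : (((N - 1) / d : ℕ) : ℝ) ≤ ((N : ℝ) - 1) / d := by
      refine Nat.cast_div_le.trans_eq ?_
      rw [Nat.cast_sub (by omega), Nat.cast_one]
    calc (((N - 1) / d : ℕ) : ℝ) * h ≤ ((N : ℝ) - 1) / d * h := by gcongr
      _ = (T - t₀) / d := by rw [hh]; field_simp
      _ < η' := by rw [div_lt_iff₀ hd0, mul_comm]; rwa [div_lt_iff₀ hη'0] at hd
  set x := (c - t₀) / h with hx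
  have hx0 : 0 ≤ x := div_nonneg (by linarith [hc.1]) hh0.le
  have hxh : x * h = c - t₀ := div_mul_cancel₀ _ hh0.ne'
  have hbound : ∀ i < (N - 1) / d, c < t₀ + ((⌊x⌋₊ + 1 + i : ℕ) : ℝ) * h ∧
      t₀ + ((⌊x⌋₊ + 1 + i : ℕ) : ℝ) * h < c + η' := by
    intro i hi
    have h1 := Nat.floor_le hx0
    have h2 := Nat.lt_floor_add_one x
    have h3 : ((i : ℝ) + 1) ≤ (((N - 1) / d : ℕ) : ℝ) := by exact_mod_cast hi
    have h4 : (0 : ℝ) ≤ i := by positivity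
    push_cast
    constructor
    · nlinarith
    · nlinarith
  have hlt : ∀ i < (N - 1) / d, ⌊x⌋₊ + 1 + i < N := by
    intro i hi
    have h1 : ((⌊x⌋₊ + 1 + i : ℕ) : ℝ) * h < ((N : ℝ) - 1) * h := by
      have h2 : ((N : ℝ) - 1) * h = T - t₀ := by rw [hh]; field_simp
      have h3 : η' ≤ T - c := min_le_right _ _
      linarith [(hbound i hi).2]
    have h2 := lt_of_mul_lt_mul_right h1 hh0.le
    have h3 : ((⌊x⌋₊ + 1 + i : ℕ) : ℝ) < N := by linarith
    exact_mod_cast h3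
  refine ⟨fun i => ⟨⌊x⌋₊ + 1 + i, hlt i i.2⟩, fun i j hij => ?_, fun i => ?_⟩
  · simp only [Fin.mk.injEq] at hij
    exact Fin.ext (by omega)
  · obtain ⟨h1, h2⟩ := hbound i i.2
    have h3 : η' ≤ η := min_le_left _ _
    rw [rbfCenter, abs_lt]
    constructor <;> dsimp only <;> linarith

/-- Once the term `N = 0` is split off, each exponent occurs exactly `d` times, which leaves `d`
copies of a geometric series. -/
theorem ENNReal.tsum_pow_div_ne_top {r : ENNReal} (hr : r < 1) {d : ℕ} (hd : 0 < d) :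
    ∑' N : ℕ, r ^ ((N - 1) / d) ≠ ⊤ := by
  have : NeZero d := ⟨hd.ne'⟩
  rw [tsum_eq_zero_add' ENNReal.summable]
  simp only [Nat.add_sub_cancel]
  have h1 : ∑' N : ℕ, r ^ (N / d) = ∑' k : ℕ, ∑' _ : Fin d, r ^ k := by
    rw [← ENNReal.tsum_prod, ← (Nat.divModEquiv d).tsum_eq]
    rfl
  have h2 : ∑' k : ℕ, ∑' _ : Fin d, r ^ k = d * (1 - r)⁻¹ := by
    simp [tsum_fintype, ENNReal.tsum_mul_left, ENNReal.tsum_geometric]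
  rw [h1, h2]
  refine ENNReal.add_ne_top.2 ⟨by simp, ENNReal.mul_ne_top (by simp) ?_⟩
  exact ENNReal.inv_ne_top.2 (tsub_pos_of_lt hr).ne'

theorem cond_volume_Ioo_compl_ball_lt_one {a b x η : ℝ} (hx : x ∈ Ioo a b) (hη : 0 < η) :
    ProbabilityTheory.cond volume (Ioo a b) (Metric.ball x η)ᶜ < 1 := by
  have hab : a < b := hx.1.trans hx.2
  have : IsProbabilityMeasure (ProbabilityTheory.cond (volume : Measure ℝ) (Ioo a b)) :=
    cond_isProbabilityMeasure_of_finite (by simpa using hab) (by simp)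
  have hpos : ProbabilityTheory.cond volume (Ioo a b) (Metric.ball x η) ≠ 0 := by
    rw [cond_apply measurableSet_Ioo]
    refine mul_ne_zero (ENNReal.inv_ne_zero.2 (by simp)) ?_
    exact ((isOpen_Ioo.inter Metric.isOpen_ball).measure_pos volume
      ⟨x, hx, Metric.mem_ball_self hη⟩).ne'
  rw [prob_compl_eq_one_sub Metric.isOpen_ball.measurableSet]
  exact ENNReal.sub_lt_self (by simp) one_ne_zero hpos

theorem IsIIDUniform.precomp {κ κ' : Type*} {a b : ℝ} {X : κ → Ω → ℝ}
    (h : IsIIDUniform P a b X) {e : κ' → κ} (he : Function.Injective e) :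
    IsIIDUniform P a b fun k => X (e k) :=
  ⟨fun k => h.1 (e k), h.2.1.precomp he, fun k => h.2.2 (e k)⟩

theorem IsIIDUniform.measure_forall_notMem {κ : Type*} [Fintype κ] {a b : ℝ} {X : κ → Ω → ℝ}
    (h : IsIIDUniform P a b X) {A : Set ℝ} (hA : MeasurableSet A) :
    P {ω | ∀ k, X k ω ∈ A} = ProbabilityTheory.cond volume (Ioo a b) A ^ Fintype.card κ := by
  have h1 := h.2.1.measure_inter_preimage_eq_mul Finset.univ (sets := fun _ => A) fun _ _ => hA
  have h2 : {ω | ∀ k, X k ω ∈ A} = ⋂ k ∈ Finset.univ, X k ⁻¹' A := by ext; simp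
  have h3 : ∀ k, P (X k ⁻¹' A) = ProbabilityTheory.cond volume (Ioo a b) A := fun k => by
    rw [← Measure.map_apply (h.1 k) hA, h.2.2 k]
  rw [h2, h1]
  simp [h3]

/-- The probabilities that none of the sampled pairs (shape parameter, centre) comes close to
a given pair are summable in the number of samples. -/
theorem tsum_measure_forall_dist_ge_ne_top {a b t₀ T : ℝ} {X : (N : ℕ) → Fin N → Ω → ℝ}
    (hX : ∀ N, IsIIDUniform P a b (X N)) {x : ℝ × ℝ} (hx : x ∈ Ioo a b ×ˢ Ioo t₀ T) {η : ℝ}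
    (hη : 0 < η) :
    ∑' N, P {ω | ¬ ∃ j, dist (X N j ω, rbfCenter t₀ T N j) x < η} ≠ ⊤ := by
  obtain ⟨d, hd, hcen⟩ := exists_injective_rbfCenter_sub_lt hx.2 hη
  refine ne_top_of_le_ne_top
    (ENNReal.tsum_pow_div_ne_top (cond_volume_Ioo_compl_ball_lt_one hx.1 hη) hd)
    (ENNReal.tsum_le_tsum fun N => ?_)
  obtain ⟨e, he, hdist⟩ := hcen N
  have h1 := ((hX N).precomp he).measure_forall_notMem
    (A := (Metric.ball x.1 η)ᶜ) Metric.isOpen_ball.measurableSet.compl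
  rw [Fintype.card_fin] at h1
  rw [← h1]
  refine measure_mono fun ω hω i hi => hω ⟨e i, ?_⟩
  rw [Prod.dist_eq, max_lt_iff]
  exact ⟨hi, hdist i⟩

theorem tsum_measure_biUnion_finset_ne_top {κ : Type*} (s : Finset κ) {A : κ → ℕ → Set Ω}
    (h : ∀ k ∈ s, ∑' N, P (A k N) ≠ ⊤) : ∑' N, P (⋃ k ∈ s, A k N) ≠ ⊤ := by
  refine ne_top_of_le_ne_top ?_ (ENNReal.tsum_le_tsum fun N => measure_biUnion_finset_le s _)
  rw [Summable.tsum_finsetSum fun _ _ => ENNReal.summable]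
  exact ENNReal.sum_ne_top.2 h

end Sampling

/-! ### Choice of the output weights and convergence. -/

section Approximation

variable {Ω : Type*} [MeasurableSpace Ω] {P : Measure Ω}

/-- The weights must not depend on the target accuracy. The infimum of the achievable errors need
not be attained, so a near-minimiser with slack `δ` is taken. -/
theorem exists_forall_exists_imp_add {κ : Type*} [Nonempty κ] {Q : κ → ℝ → Prop}
    (hmono : ∀ w ε ε', ε ≤ ε' → Q w ε → Q w ε') (hpos : ∀ w ε, Q w ε → 0 ≤ ε) {δ : ℝ}
    (hδ : 0 < δ) : ∃ w, ∀ ε, (∃ w', Q w' ε) → Q w (ε + δ) := by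
  let S : Set ℝ := {ε | ∃ w', Q w' ε}
  by_cases hS : S.Nonempty
  · obtain ⟨e, ⟨w, hw⟩, he⟩ := exists_lt_of_csInf_lt hS (lt_add_of_pos_right (sInf S) hδ)
    refine ⟨w, fun ε hε => hmono w e _ ?_ hw⟩
    have : sInf S ≤ ε := csInf_le ⟨0, fun ε ⟨w, hw⟩ => hpos w ε hw⟩ hε
    linarith
  · exact ⟨Classical.arbitrary κ, fun ε hε => (hS ⟨ε, hε⟩).elim⟩

/-- The probabilities that no choice of output weights gives a uniform error below `ε` are
summable. -/
theorem tsum_measure_not_exists_pirpnn_lt_ne_top {a b t₀ T z : ℝ} (ha : 0 ≤ a) (hab : a < b)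
    (hT : t₀ < T) {X : (N : ℕ) → Fin N → Ω → ℝ} (hX : ∀ N, IsIIDUniform P a b (X N)) {u : ℝ → ℝ}
    (hu : ContinuousOn u (Icc t₀ T)) (hz : u t₀ = z) {ε : ℝ} (hε : 0 < ε) :
    ∑' N, P {ω | ¬ ∃ w : Fin N → ℝ, ∀ t ∈ Icc t₀ T,
      |pirpnn t₀ T z (fun j => X N j ω) w t - u t| < ε} ≠ ⊤ := by
  obtain ⟨φ, hφ⟩ := exists_continuousMap_sub_mul_lt (h := fun t => u t - z) hT
    (hu.sub continuousOn_const) (by simp [hz]) (half_pos hε)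
  obtain ⟨α, hα⟩ := exists_between hab
  have hl : 0 < T - t₀ := sub_pos.2 hT
  obtain ⟨s, hs, η, hη, happ⟩ := exists_finset_forall_exists_mem_span
    (continuous_gaussianMap t₀ T) (ψ := φ) (S := {α} ×ˢ Ioo t₀ T)
    (by rw [topologicalClosure_span_gaussianMap (ha.trans_lt hα.1) hT]; trivial)
    (div_pos (half_pos hε) hl)
  have hsum : ∑' N, P (⋃ x ∈ s, {ω | ¬ ∃ j, dist (X N j ω, rbfCenter t₀ T N j) x < η}) ≠ ⊤ := by
    refine tsum_measure_biUnion_finset_ne_top s fun x hx =>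
      tsum_measure_forall_dist_ge_ne_top hX ⟨?_, (hs hx).2⟩ hη
    rw [show x.1 = α from (hs hx).1]
    exact hα
  refine ne_top_of_le_ne_top hsum (ENNReal.tsum_le_tsum fun N => measure_mono fun ω hω => ?_)
  by_contra hcon
  refine hω ?_
  simp only [mem_iUnion, mem_ofPred_eq, exists_prop] at hcon
  obtain ⟨χ, hχ, hd⟩ := happ (fun j => (X N j ω, rbfCenter t₀ T N j)) (by push Not at hcon; exact hcon)
  obtain ⟨w, rfl⟩ := (Submodule.mem_span_range_iff_exists_fun ℝ).1 hχ
  refine ⟨w, fun t ht => ?_⟩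
  have h1 := hφ ⟨t, ht⟩
  have h2 := (ContinuousMap.dist_apply_le_dist (⟨t, ht⟩ : Icc t₀ T)).trans_lt hd
  rw [Real.dist_eq, lt_div_iff₀ hl] at h2
  simp only [ContinuousMap.sum_apply, ContinuousMap.smul_apply, gaussianMap_apply,
    smul_eq_mul] at h1 h2
  set χt := ∑ j, w j * gaussianRBF 1 0 (X N j ω) (rbfCenter t₀ T N j) t with hχt
  have h3 : pirpnn t₀ T z (fun j => X N j ω) w t - u t =
      ((t - t₀) * φ ⟨t, ht⟩ - (u t - z)) - (t - t₀) * (φ ⟨t, ht⟩ - χt) := by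
    rw [pirpnn, hχt]; ring
  have h4 : |(t - t₀) * (φ ⟨t, ht⟩ - χt)| < ε / 2 := by
    rw [abs_mul, abs_of_nonneg (sub_nonneg.2 ht.1), mul_comm]
    refine lt_of_le_of_lt ?_ h2
    gcongr
    exact ht.2
  rw [h3]
  linarith [abs_sub ((t - t₀) * φ ⟨t, ht⟩ - (u t - z)) ((t - t₀) * (φ ⟨t, ht⟩ - χt))]

theorem pirpnnConverges_of_continuousOn {ι : Type*} [Fintype ι] {a b t₀ T : ℝ} (ha : 0 ≤ a)
    (hab : a < b) (hT : t₀ < T) {α : (N : ℕ) → ι → Fin N → Ω → ℝ}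
    (hα : ∀ N, IsIIDUniform P a b (fun k : ι × Fin N => α N k.1 k.2)) {z : ι → ℝ}
    {u : ℝ → ι → ℝ} (hu : ContinuousOn u (Icc t₀ T)) (hz : u t₀ = z) :
    PIRPNNConverges P α t₀ T z u := by
  let Q : (N : ℕ) → ι → (Fin N → ℝ) → (Fin N → ℝ) → ℝ → Prop := fun N i β w ε =>
    ∀ t ∈ Icc t₀ T, |pirpnn t₀ T (z i) β w t - u t i| < ε
  have hδ : ∀ N : ℕ, (0 : ℝ) < 1 / ((N : ℝ) + 1) := fun N => Nat.one_div_pos_of_nat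
  have hbest : ∀ N i β, ∃ w, ∀ ε, (∃ w', Q N i β w' ε) → Q N i β w (ε + 1 / ((N : ℝ) + 1)) :=
    fun N i β => exists_forall_exists_imp_add (fun w ε ε' hle h t ht => (h t ht).trans_le hle)
      (fun w ε h => (abs_nonneg _).trans (h t₀ ⟨le_rfl, hT.le⟩).le) (hδ N)
  choose W hW using hbest
  -- The bad events are never shown to be measurable; upper bounds on `P` suffice for both modes of
  -- convergence.
  let A : ℝ → ℕ → Set Ω := fun ε N =>
    ⋃ i ∈ Finset.univ, {ω | ¬ ∃ w, Q N i (fun j => α N i j ω) w ε}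
  have hA : ∀ ε > 0, ∑' N, P (A ε N) ≠ ⊤ := fun ε hε =>
    tsum_measure_biUnion_finset_ne_top _ fun i _ =>
      tsum_measure_not_exists_pirpnn_lt_ne_top ha hab hT
        (fun N => (hα N).precomp (e := fun j => (i, j)) (Prod.mk_right_injective i))
        ((continuous_apply i).comp_continuousOn hu) (congrFun hz i) hε
  have hgood : ∀ ε > 0, ∀ᶠ N in atTop, ∀ ω ∉ A (ε / 2) N, ∀ i,
      Q N i (fun j => α N i j ω) (W N i fun j => α N i j ω) ε := by
    intro ε hε
    filter_upwards [tendsto_one_div_add_atTop_nhds_zero_nat.eventually_lt_const (half_pos hε)]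
      with N hN ω hω i t ht
    have h1 : ∃ w, Q N i (fun j => α N i j ω) w (ε / 2) := by
      by_contra hcon
      exact hω (mem_biUnion (Finset.mem_coe.2 (Finset.mem_univ i)) hcon)
    exact (hW N i _ _ h1 t ht).trans (by linarith)
  refine ⟨fun N β i => W N i (β i), fun ε hε δ hδ => ?_, ?_⟩
  · have h1 := ENNReal.tendsto_atTop_zero_of_tsum_ne_top (hA (ε / 2) (half_pos hε))
    have h2 := h1.eventually_le_const (ENNReal.ofReal_pos.2 hδ)
    obtain ⟨N₀, hN₀⟩ := eventually_atTop.1 ((hgood ε hε).and h2)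
    refine ⟨N₀, fun N hN => le_trans (measure_mono ?_) (hN₀ N hN).2⟩
    rintro ω ⟨i, t, ht, hle⟩
    by_contra hω
    exact absurd ((hN₀ N hN).1 ω hω i t ht) (not_lt.2 hle)
  -- Borel–Cantelli along countably many accuracies, so that one null set serves every `ε`.
  · have h1 : ∀ᵐ ω ∂P, ∀ k : ℕ, ∀ᶠ N in atTop, ω ∉ A (1 / ((k : ℝ) + 1) / 2) N :=
      ae_all_iff.2 fun k => ae_eventually_notMem (hA _ (half_pos (hδ k)))
    filter_upwards [h1] with ω hω i
    rw [Metric.tendstoUniformlyOn_iff]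
    intro ε hε
    obtain ⟨k, hk⟩ := exists_nat_one_div_lt hε
    filter_upwards [hgood _ (hδ k), hω k] with N hN hωN t ht
    rw [dist_comm, Real.dist_eq]
    exact (hN ω hωN i t ht).trans hk

end Approximation

theorem proposition1 {Ω : Type*} [MeasurableSpace Ω] (P : Measure Ω) [IsProbabilityMeasure P]
    (a b : ℝ) (ha : 0 ≤ a) (hab : a < b) (t₀ : ℝ) :
    -- ODEs in canonical form
    (∀ (m : ℕ) (f : ℝ → (Fin m → ℝ) → (Fin m → ℝ)) (D : Set (ℝ × (Fin m → ℝ))) (z : Fin m → ℝ),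
      ContinuousOn (fun x : ℝ × (Fin m → ℝ) => f x.1 x.2) D →
      (∃ K, ∀ t, LipschitzOnWith K (f t) {x | (t, x) ∈ D}) →
      (D ∈ 𝓝[Ici t₀ ×ˢ univ] (t₀, z) → ∃ T > t₀, ∃ u, IsODESolution f D t₀ T z u) ∧
      ∀ T > t₀, ∀ u, IsODESolution f D t₀ T z u →
        (∀ u', IsODESolution f D t₀ T z u' → EqOn u' u (Icc t₀ T)) ∧
        ContDiffOn ℝ 1 u (Icc t₀ T) ∧
        ∀ α : (N : ℕ) → Fin m → Fin N → Ω → ℝ,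
          (∀ N, IsIIDUniform P a b (fun k : Fin m × Fin N => α N k.1 k.2)) →
          PIRPNNConverges P α t₀ T z u) ∧
    -- index-1 DAEs in semiexplicit form
    (∀ (p q : ℕ) (f : ℝ → (Fin p → ℝ) → (Fin q → ℝ) → (Fin p → ℝ))
      (g : ℝ → (Fin p → ℝ) → (Fin q → ℝ) → (Fin q → ℝ))
      (D : Set (ℝ × (Fin p → ℝ) × (Fin q → ℝ))) (z : Fin p → ℝ) (y : Fin q → ℝ),
      ContinuousOn (fun x : ℝ × (Fin p → ℝ) × (Fin q → ℝ) => f x.1 x.2.1 x.2.2) D →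
      (∃ K, ∀ t, LipschitzOnWith K (fun x : (Fin p → ℝ) × (Fin q → ℝ) => f t x.1 x.2)
        {x | (t, x) ∈ D}) →
      (∀ x ∈ D, ContDiffAt ℝ 1
        (fun x : ℝ × (Fin p → ℝ) × (Fin q → ℝ) => g x.1 x.2.1 x.2.2) x) →
      (∀ x ∈ D, g x.1 x.2.1 x.2.2 = 0 → (fderiv ℝ (g x.1 x.2.1) x.2.2).det ≠ 0) →
      (D ∈ 𝓝[Ici t₀ ×ˢ univ] (t₀, z, y) → g t₀ z y = 0 →
        ∃ T > t₀, ∃ u v, IsDAESolution f g D t₀ T z y u v) ∧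
      ∀ T > t₀, ∀ u v, IsDAESolution f g D t₀ T z y u v →
        (∀ u' v', IsDAESolution f g D t₀ T z y u' v' →
          EqOn u' u (Icc t₀ T) ∧ EqOn v' v (Icc t₀ T)) ∧
        ContDiffOn ℝ 1 u (Icc t₀ T) ∧
        ∀ α : (N : ℕ) → Fin p ⊕ Fin q → Fin N → Ω → ℝ,
          (∀ N, IsIIDUniform P a b (fun k : (Fin p ⊕ Fin q) × Fin N => α N k.1 k.2)) →
          PIRPNNConverges P α t₀ T (Sum.elim z y) (fun t => Sum.elim (u t) (v t))) := by
  refine ⟨fun m f D z hc ⟨K, hl⟩ => ⟨fun hD =>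
      exists_forall_mem_hasDerivWithinAt_of_lipschitzOnWith hc hl hD, fun T hT u hu =>
      ⟨fun u' hu' => hu.eqOn hl hu', hu.contDiffOn hT hc, fun α hα =>
        pirpnnConverges_of_continuousOn ha hab hT hα hu.continuousOn hu.1⟩⟩,
    fun p q f g D z y hc ⟨K, hl⟩ hg hdet => ⟨fun hD hg0 =>
      exists_isDAESolution hc hl hg hdet hD hg0, fun T hT u v h =>
      ⟨fun u' v' h' => h.eqOn hl hg hdet h', h.contDiffOn hT hc, fun α hα =>
        pirpnnConverges_of_continuousOn ha hab hT hα ?_ ?_⟩⟩⟩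
  · refine continuousOn_pi.2 fun i => ?_
    rcases i with i | i
    · exact (continuous_apply i).comp_continuousOn h.continuousOn.snd.fst
    · exact (continuous_apply i).comp_continuousOn h.2.2.1
  · rw [h.1, h.2.1]
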